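/- Lemma 5.2 (Strong Convexity of ReLU). Write $\mathsf{ReLU}(a)=\max(0,a)$ and, for $w\in\mathbb{R}^d$, $\mathsf{ReLU}_w(x)=\mathsf{ReLU}(\langle w,x\rangle)$. For a probability distribution $\mathcal{D}$ on $\mathbb{R}^d\times\mathbb{R}$ with marginal $\mathcal{D}_{\mathcal{X}}$ on $\mathbb{R}^d$ and for $f:\mathbb{R}^d\to\mathbb{R}$, let $\chi_{\mathcal{D}}^{f}=\mathbb{E}_{x\sim\mathcal{D}_{\mathcal{X}}}[f(x)\,x]\in\mathbb{R}^d$ be the vector of Chow parameters of $f$. Call $\mathcal{D}_{\mathcal{X}}$ isotropic if $\mathbb{E}[x]=0$ and $\mathbb{E}[xx^{T}]=I$, and log-concave if it has a density $g\ge 0$ with respect to Lebesgue measure such that $g(ax+by)\ge g(x)^{a}g(y)^{b}$ for all $x,y$ and all $a,b\ge 0$ with $a+b=1$. There is a universal constant $\mu>0$, depending neither on the dimension $d$ nor on the distribution, such that for every $d$ and every probability distribution $\mathcal{D}$ on $\mathbb{R}^d\times\mathbb{R}$ whose marginal $\mathcal{D}_{\mathcal{X}}$ is isotropic and log-concave,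 $$\langle \chi_{\mathcal{D}}^{\mathsf{ReLU}_u}-\chi_{\mathcal{D}}^{\mathsf{ReLU}_v},\,u-v\rangle\ \ge\ \mu\,\|u-v\|_2^2\qquad\text{for all }u,v\in\mathbb{R}^d .$$ In other words, the surrogate loss $L^{\mathsf{surr}}_{\mathcal{D}}(w)=\mathbb{E}_{(x,y)\sim\mathcal{D}}\Big[\int_0^{\langle w,x\rangle}(\mathsf{ReLU}(a)-y)\,da\Big]$ is $\mu$-strongly convex on $\mathbb{R}^d$ whenever $\mathbb{E}\|yx\|_2<\infty$ (for instance, whenever the labels $y$ are bounded), that is, $L^{\mathsf{surr}}_{\mathcal{D}}(au+bv)\le a\,L^{\mathsf{surr}}_{\mathcal{D}}(u)+b\,L^{\mathsf{surr}}_{\mathcal{D}}(v)-\frac{\mu}{2}\,ab\,\|u-v\|_2^2$ for all $u,v\in\mathbb{R}^d$ and $a,b\ge 0$ with $a+b=1$. -/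

import Mathlib

open MeasureTheory

noncomputable section

/-- The activation `ReLU(a) = max(0, a)`. -/
def relu (a : ℝ) : ℝ := max 0 a

/-- The generalized linear model `σ_w : x ↦ σ(⟨w, x⟩)`. -/
def glm {d : ℕ} (σ : ℝ → ℝ) (w x : EuclideanSpace ℝ (Fin d)) : ℝ := σ (inner ℝ w x)

/-- The (degree-1) Chow parameters `χ_D^f = E_{x ∼ D_X}[f(x) x]` of `f`; here `D.fst` is the
marginal `D_X` on the examples of the distribution `D` of labelled examples `(x, y)`. -/
def chow {d : ℕ} (D : Measure (EuclideanSpace ℝ (Fin d) × ℝ))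
    (f : EuclideanSpace ℝ (Fin d) → ℝ) : EuclideanSpace ℝ (Fin d) :=
  ∫ x, f x • x ∂D.fst

/-- `E[x] = 0` and `E[x xᵀ] = I` (the latter entrywise). The diagonal entries being `1` forces
all second moments to exist. -/
def IsIsotropic {d : ℕ} (ν : Measure (EuclideanSpace ℝ (Fin d))) : Prop :=
  ∫ x, x ∂ν = 0 ∧ ∀ i j : Fin d, ∫ x, x i * x j ∂ν = (1 : Matrix (Fin d) (Fin d) ℝ) i j

/-- `f ≥ 0` and `f(a x + b y) ≥ f(x)^a f(y)^b` for all `a, b ≥ 0` with `a + b = 1`,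
that is, `log f` is concave with values in `[-∞, ∞)`. -/
def IsLogConcaveFun {d : ℕ} (f : EuclideanSpace ℝ (Fin d) → ℝ) : Prop :=
  (∀ x, 0 ≤ f x) ∧
    ∀ x y : EuclideanSpace ℝ (Fin d), ∀ a b : ℝ, 0 ≤ a → 0 ≤ b → a + b = 1 →
      f x ^ a * f y ^ b ≤ f (a • x + b • y)

/-- A log-concave distribution on `ℝ^d`: it has a log-concave density with respect to
Lebesgue measure. -/
def IsLogConcave {d : ℕ} (ν : Measure (EuclideanSpace ℝ (Fin d))) : Prop :=
  ∃ f : EuclideanSpace ℝ (Fin d) → ℝ, Measurable f ∧ IsLogConcaveFun f ∧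
    ν = volume.withDensity (fun x => ENNReal.ofReal (f x))

/-- The activation `σ` satisfies `m`-strong convexity with respect to `D`:
`⟨χ_D^{σ_u} - χ_D^{σ_v}, u - v⟩ ≥ m ‖u - v‖²` for all `u, v`. -/
def SatisfiesStrongConvexity {d : ℕ} (m : ℝ) (σ : ℝ → ℝ)
    (D : Measure (EuclideanSpace ℝ (Fin d) × ℝ)) : Prop :=
  ∀ u v : EuclideanSpace ℝ (Fin d),
    m * ‖u - v‖ ^ 2 ≤ inner ℝ (chow D (glm σ u) - chow D (glm σ v)) (u - v)

/-- The surrogate loss `L^surr_D(w) = E_{(x, y) ∼ D}[∫_0^{⟨w, x⟩} (σ(a) - y) da]`. -/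
def surrogateLoss {d : ℕ} (σ : ℝ → ℝ) (D : Measure (EuclideanSpace ℝ (Fin d) × ℝ))
    (w : EuclideanSpace ℝ (Fin d)) : ℝ :=
  ∫ p, (∫ a in (0 : ℝ)..(inner ℝ w p.1), (σ a - p.2)) ∂D

end

/-! Put F(w) = E[relu⟨w,x⟩²]/2, whose gradient is formally the Chow vector of `glm relu w`. Both
claims follow from one quadratic lower bound on the Bregman divergence of F,
`IsLogConcave.integral_relu_sq_ge`; the labels enter the surrogate loss only through a linear term.

Pointwise, the divergence of relu²/2 is at least (p - q)²/8 when p + q ≥ 0 (`relu_bregman_ge`). With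
p = ⟨u,x⟩ and q = ⟨z,x⟩ this condition cuts out a halfspace through the origin, so it suffices that
every such halfspace carries a fixed fraction of E⟨w,x⟩²
(`IsLogConcave.integral_indicator_inner_sq_ge`). That holds because its mass is bounded below and
⟨w,x⟩ is rarely near 0, both consequences of P(|⟨w,x⟩| ≤ ε) ≤ 6ε for unit w.

For this anti-concentration, Prékopa–Leindler makes the tails of ⟨w,x⟩ log-concave. Mass p on [-ε,
ε] then forces exponential decay at rate p/(2ε) on both sides, which contradicts unit variance
unless p = O(ε). -/

section

open Set Filter Topology ENNReal Pointwise
open scoped RealInnerProductSpace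

/-! ### Brunn–Minkowski and Prékopa–Leindler inequalities -/

/-- Brunn–Minkowski on the line, for compact sets. -/
theorem volume_add_le_of_isCompact {K L C : Set ℝ} (hK : IsCompact K) (hL : IsCompact L)
    (hK0 : K.Nonempty) (hL0 : L.Nonempty) (h : ∀ x ∈ K, ∀ y ∈ L, x + y ∈ C) :
    volume K + volume L ≤ volume C := by
  -- The translates K + l and k + L both lie in C and meet only at k + l, so cutting C there
  -- separates them up to a null set.
  set k := sSup K
  set l := sInf L
  have hk : k ∈ K := hK.sSup_mem hK0
  have hl : l ∈ L := hL.sInf_mem hL0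
  have hkK : ∀ x ∈ K, x ≤ k := fun x hx => le_csSup hK.bddAbove hx
  have hlL : ∀ y ∈ L, l ≤ y := fun y hy => csInf_le hL.bddBelow hy
  rw [← measure_inter_add_sdiff C (measurableSet_Iic (a := k + l))]
  refine add_le_add ?_ ?_
  · rw [← measure_preimage_add_right volume l (C ∩ Iic (k + l))]
    exact measure_mono fun x hx => ⟨h x hx l hl, by simpa using hkK x hx⟩
  · rw [← measure_preimage_add volume k (C \ Iic (k + l)),
      ← measure_sdiff_null (s := L) (measure_singleton l)]
    refine measure_mono fun y hy => ⟨h k hk y hy.1, ?_⟩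
    have := lt_of_le_of_ne (hlL y hy.1) (fun e => hy.2 e.symm)
    simpa using this

/-- Brunn–Minkowski on the line. -/
theorem volume_smul_add_smul_le {A B C : Set ℝ} {a b : ℝ} (ha : 0 < a) (hb : 0 < b)
    (hA : MeasurableSet A) (hB : MeasurableSet B) (hA0 : A.Nonempty) (hB0 : B.Nonempty)
    (h : ∀ x ∈ A, ∀ y ∈ B, a * x + b * y ∈ C) :
    ENNReal.ofReal a * volume A + ENNReal.ofReal b * volume B ≤ volume C := by
  have key : ∀ (S : Set ℝ) (c : ℝ), 0 < c → MeasurableSet S → S.Nonempty → ∀ r,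
      r < ENNReal.ofReal c * volume S →
      ∃ K ⊆ S, IsCompact K ∧ K.Nonempty ∧ r ≤ volume ((fun x => c * x) '' K) := by
    intro S c hc hS hS0 r hr
    have hc' : ENNReal.ofReal c ≠ 0 := by simpa using hc
    have hvol : ∀ K : Set ℝ, volume ((fun x => c * x) '' K) = ENNReal.ofReal c * volume K := by
      intro K
      rw [show (fun x => c * x) '' K = c • K from rfl, Measure.addHaar_smul]
      simp [abs_of_pos hc]
    have hr' : r / ENNReal.ofReal c < volume S :=
      ENNReal.div_lt_of_lt_mul' hr
    obtain ⟨K, hKS, hK, hlt⟩ := hS.exists_lt_isCompact hr'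
    refine ⟨K, hKS, hK, ?_, ?_⟩
    · rw [nonempty_iff_ne_empty]
      rintro rfl
      simp at hlt
    · rw [hvol]
      rw [ENNReal.div_lt_iff (Or.inl hc') (Or.inl ENNReal.ofReal_ne_top)] at hlt
      rw [mul_comm]; exact hlt.le
  -- A nonempty null set has no r below its measure; the alternative r = 0 lets a single point serve
  -- as the compact set.
  have key' : ∀ (S : Set ℝ) (c : ℝ), 0 < c → MeasurableSet S → S.Nonempty → ∀ r,
      (r < ENNReal.ofReal c * volume S ∨ r = 0) →
      ∃ K ⊆ S, IsCompact K ∧ K.Nonempty ∧ r ≤ volume ((fun x => c * x) '' K) := by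
    rintro S c hc hS ⟨s, hs⟩ r (hr | rfl)
    · exact key S c hc hS ⟨s, hs⟩ r hr
    · exact ⟨{s}, by simpa using hs, isCompact_singleton, singleton_nonempty _, zero_le⟩
  have main : ∀ r s, (r < ENNReal.ofReal a * volume A ∨ r = 0) →
      (s < ENNReal.ofReal b * volume B ∨ s = 0) → r + s ≤ volume C := by
    intro r s hr hs
    obtain ⟨K, hKA, hK, hK0, hrK⟩ := key' A a ha hA hA0 r hr
    obtain ⟨L, hLB, hL, hL0, hsL⟩ := key' B b hb hB hB0 s hs
    refine (add_le_add hrK hsL).trans (volume_add_le_of_isCompact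
      (hK.image (by fun_prop)) (hL.image (by fun_prop)) (hK0.image _) (hL0.image _) ?_)
    rintro _ ⟨x, hx, rfl⟩ _ ⟨y, hy, rfl⟩
    exact h x (hKA hx) y (hLB hy)
  have step : ∀ s, (s < ENNReal.ofReal b * volume B ∨ s = 0) →
      ENNReal.ofReal a * volume A + s ≤ volume C := by
    intro s hs
    have hst : s ≠ ∞ := by rcases hs with hs | rfl; exacts [hs.ne_top, by simp]
    refine add_le_of_le_tsub_right_of_le ?_ ?_
    · simpa using main 0 s (Or.inr rfl) hs
    · refine le_of_forall_lt fun r hr => ?_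
      obtain ⟨r', hr', hr''⟩ := exists_between hr
      exact hr'.trans_le (ENNReal.le_sub_of_add_le_right hst (main r' s (Or.inl hr'') hs))
  by_cases hT : ENNReal.ofReal a * volume A = ∞
  · have := step 0 (Or.inr rfl)
    rw [hT] at this ⊢
    simpa using this
  · refine add_le_of_le_tsub_left_of_le ?_ ?_
    · simpa using step 0 (Or.inr rfl)
    · refine le_of_forall_lt fun r hr => ?_
      obtain ⟨r', hr', hr''⟩ := exists_between hr
      exact hr'.trans_le (ENNReal.le_sub_of_add_le_left hT (step r' (Or.inl hr'')))

/-- The additive Prékopa–Leindler inequality on the line for functions with supremum one. -/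
theorem lintegral_add_le_of_iSup_eq_one {f g h : ℝ → ℝ} {a b : ℝ} (ha : 0 < a) (hb : 0 < b)
    (hab : a + b = 1) (hf : Measurable f) (hg : Measurable g) (hh : Measurable h)
    (hf0 : ∀ x, 0 ≤ f x) (hg0 : ∀ x, 0 ≤ g x) (hh0 : ∀ x, 0 ≤ h x)
    (hf1 : ∀ x, f x ≤ 1) (hg1 : ∀ x, g x ≤ 1)
    (hfs : ∀ t < 1, ∃ x, t < f x) (hgs : ∀ t < 1, ∃ x, t < g x)
    (hfg : ∀ x y, f x ^ a * g y ^ b ≤ h (a * x + b * y)) :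
    ENNReal.ofReal a * (∫⁻ x, ENNReal.ofReal (f x)) + ENNReal.ofReal b * (∫⁻ x, ENNReal.ofReal (g x))
      ≤ ∫⁻ x, ENNReal.ofReal (h x) := by
  rw [lintegral_eq_lintegral_meas_lt volume (ae_of_all _ hf0) hf.aemeasurable,
    lintegral_eq_lintegral_meas_lt volume (ae_of_all _ hg0) hg.aemeasurable,
    lintegral_eq_lintegral_meas_lt volume (ae_of_all _ hh0) hh.aemeasurable]
  have hm : ∀ u : ℝ → ℝ, Measurable fun t : ℝ => volume {x | t < u x} := fun u =>
    Antitone.measurable fun s t hst => measure_mono fun x (hx : t < u x) => hst.trans_lt hx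
  rw [← lintegral_const_mul _ (hm f), ← lintegral_const_mul _ (hm g),
    ← lintegral_add_left ((hm f).const_mul _)]
  refine setLIntegral_mono (hm h) fun t (ht : 0 < t) => ?_
  -- Supremum one makes both superlevel sets nonempty exactly for t < 1, as Brunn–Minkowski
  -- requires; for t ≥ 1 both are empty.
  rcases lt_or_ge t 1 with ht1 | ht1
  · refine volume_smul_add_smul_le ha hb (measurableSet_lt measurable_const hf)
      (measurableSet_lt measurable_const hg) (hfs t ht1) (hgs t ht1) ?_
    intro x (hx : t < f x) y (hy : t < g y)
    refine lt_of_lt_of_le ?_ (hfg x y)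
    calc t = t ^ a * t ^ b := by rw [← Real.rpow_add ht, hab, Real.rpow_one]
      _ < f x ^ a * g y ^ b := by gcongr
  · have e1 : {x | t < f x} = ∅ := by
      ext x; simpa using (hf1 x).trans ht1
    have e2 : {x | t < g x} = ∅ := by
      ext x; simpa using (hg1 x).trans ht1
    simp [e1, e2]

theorem ENNReal.rpow_mul_rpow_le_add {a b : ℝ} (ha : 0 < a) (hb : 0 < b) (hab : a + b = 1)
    (x y : ℝ≥0∞) : x ^ a * y ^ b ≤ ENNReal.ofReal a * x + ENNReal.ofReal b * y := by
  have ha' : ENNReal.ofReal a ≠ 0 := by simpa using ha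
  have hb' : ENNReal.ofReal b ≠ 0 := by simpa using hb
  rcases eq_or_ne x ∞ with rfl | hx
  · simp [ENNReal.mul_top ha']
  rcases eq_or_ne y ∞ with rfl | hy
  · simp [ENNReal.mul_top hb']
  lift x to NNReal using hx
  lift y to NNReal using hy
  lift a to NNReal using ha.le
  lift b to NNReal using hb.le
  have := NNReal.geom_mean_le_arith_mean2_weighted a b x y (by exact_mod_cast hab)
  rw [← ENNReal.coe_rpow_of_nonneg _ ha.le, ← ENNReal.coe_rpow_of_nonneg _ hb.le,
    ENNReal.ofReal_coe_nnreal, ENNReal.ofReal_coe_nnreal]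
  exact_mod_cast this

/-- The Prékopa–Leindler inequality on the line, for bounded functions. -/
theorem prekopa_leindler_real_of_bounded {f g h : ℝ → ℝ≥0∞} {a b : ℝ} (ha : 0 < a) (hb : 0 < b)
    (hab : a + b = 1) (hf : Measurable f) (hg : Measurable g) (hh : Measurable h)
    (hfb : ⨆ x, f x ≠ ∞) (hgb : ⨆ x, g x ≠ ∞)
    (hfg : ∀ x y, f x ^ a * g y ^ b ≤ h (a * x + b * y)) :
    (∫⁻ x, f x) ^ a * (∫⁻ x, g x) ^ b ≤ ∫⁻ x, h x := by
  set A := ⨆ x, f x with hAdef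
  set B := ⨆ x, g x with hBdef
  rcases eq_or_ne A 0 with hA | hA
  · have : ∀ x, f x = 0 := fun x => le_antisymm (hA ▸ le_iSup f x) zero_le
    simp [this, ha]
  rcases eq_or_ne B 0 with hB | hB
  · have : ∀ x, g x = 0 := fun x => le_antisymm (hB ▸ le_iSup g x) zero_le
    simp [this, hb]
  set M := A ^ a * B ^ b with hM
  have hM0 : M ≠ 0 := mul_ne_zero (by simp [hA, hfb]) (by simp [hB, hgb])
  have hMt : M ≠ ∞ := ENNReal.mul_ne_top (ENNReal.rpow_ne_top_of_nonneg ha.le hfb)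
    (ENNReal.rpow_ne_top_of_nonneg hb.le hgb)
  have hle : ∀ (u : ℝ → ℝ≥0∞), (⨆ x, u x) ≠ 0 → (⨆ x, u x) ≠ ∞ → ∀ x, u x / (⨆ x, u x) ≤ 1 :=
    fun u h0 ht x => ENNReal.div_le_of_le_mul (by simpa using le_iSup u x)
  have hsup : ∀ (u : ℝ → ℝ≥0∞), (⨆ x, u x) ≠ 0 → (⨆ x, u x) ≠ ∞ → ∀ t < 1,
      ∃ x, t < (u x / (⨆ x, u x)).toReal := by
    intro u h0 ht t ht1
    have : ENNReal.ofReal t * (⨆ x, u x) < ⨆ x, u x := by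
      have h1 : ENNReal.ofReal t < 1 := by simpa using ht1
      simpa using ENNReal.mul_lt_mul_left h0 ht h1
    obtain ⟨x, hx⟩ := lt_iSup_iff.1 this
    refine ⟨x, ?_⟩
    have h2 : ENNReal.ofReal t < u x / (⨆ x, u x) :=
      (ENNReal.lt_div_iff_mul_lt (Or.inl h0) (Or.inl ht)).2 hx
    rcases lt_or_ge t 0 with h | h
    · exact h.trans_le ENNReal.toReal_nonneg
    · exact (ENNReal.ofReal_lt_iff_lt_toReal h (ne_top_of_le_ne_top one_ne_top (hle u h0 ht x))).1 h2
  have hfin : ∀ (u : ℝ → ℝ≥0∞), (⨆ x, u x) ≠ 0 → (⨆ x, u x) ≠ ∞ → ∀ x,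
      ENNReal.ofReal (u x / (⨆ x, u x)).toReal = u x / (⨆ x, u x) := fun u h0 ht x =>
    ENNReal.ofReal_toReal (ne_top_of_le_ne_top one_ne_top (hle u h0 ht x))
  -- Capping at 1 makes `toReal` harmless and costs nothing, since the normalised f and g are at
  -- most 1.
  have hmin : ∀ x, min (h x / M) 1 ≠ ∞ := fun x =>
    ne_top_of_le_ne_top one_ne_top (min_le_right _ _)
  have key := lintegral_add_le_of_iSup_eq_one (f := fun x => (f x / A).toReal)
    (g := fun x => (g x / B).toReal) (h := fun x => (min (h x / M) 1).toReal) ha hb hab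
    (by fun_prop) (by fun_prop) (by fun_prop) (fun _ => ENNReal.toReal_nonneg)
    (fun _ => ENNReal.toReal_nonneg) (fun _ => ENNReal.toReal_nonneg)
    (fun x => ENNReal.toReal_le_of_le_ofReal zero_le_one (by simpa using hle f hA hfb x))
    (fun x => ENNReal.toReal_le_of_le_ofReal zero_le_one (by simpa using hle g hB hgb x))
    (hsup f hA hfb) (hsup g hB hgb) (by
      intro x y
      simp only [ENNReal.toReal_rpow]
      rw [← ENNReal.toReal_mul]
      refine ENNReal.toReal_mono (hmin _) (le_min ?_ ?_)
      · rw [ENNReal.div_rpow_of_nonneg _ _ ha.le, ENNReal.div_rpow_of_nonneg _ _ hb.le,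
          ENNReal.le_div_iff_mul_le (Or.inl hM0) (Or.inl hMt)]
        refine le_trans (le_of_eq ?_) (hfg x y)
        have hA' : A ^ a ≠ 0 := by simp [hA, hfb]
        have hB' : B ^ b ≠ 0 := by simp [hB, hgb]
        rw [hM, mul_mul_mul_comm,
          ENNReal.div_mul_cancel hA' (ENNReal.rpow_ne_top_of_nonneg ha.le hfb),
          ENNReal.div_mul_cancel hB' (ENNReal.rpow_ne_top_of_nonneg hb.le hgb)]
      · exact mul_le_one' (ENNReal.rpow_le_one (hle f hA hfb x) ha.le)
          (ENNReal.rpow_le_one (hle g hB hgb y) hb.le))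
  have hfA : ∀ x, ENNReal.ofReal (f x / A).toReal = f x / A := hfin f hA hfb
  have hgB : ∀ x, ENNReal.ofReal (g x / B).toReal = g x / B := hfin g hB hgb
  simp only [hfA, hgB, ENNReal.ofReal_toReal (hmin _)] at key
  have hint : ∀ (u : ℝ → ℝ≥0∞), (⨆ x, u x) ≠ 0 → (⨆ x, u x) ≠ ∞ → Measurable u →
      ∫⁻ x, u x = (⨆ x, u x) * ∫⁻ x, u x / (⨆ x, u x) := by
    intro u h0 ht hu
    rw [← lintegral_const_mul _ (hu.div_const _)]
    exact lintegral_congr fun x => (ENNReal.mul_div_cancel h0 ht).symm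
  calc (∫⁻ x, f x) ^ a * (∫⁻ x, g x) ^ b
      = M * ((∫⁻ x, f x / A) ^ a * (∫⁻ x, g x / B) ^ b) := by
        rw [hint f hA hfb hf, hint g hB hgb hg, ENNReal.mul_rpow_of_nonneg _ _ ha.le,
          ENNReal.mul_rpow_of_nonneg _ _ hb.le, mul_mul_mul_comm]
    _ ≤ M * ∫⁻ x, min (h x / M) 1 := by
        gcongr
        exact (ENNReal.rpow_mul_rpow_le_add ha hb hab _ _).trans key
    _ = ∫⁻ x, M * min (h x / M) 1 := (lintegral_const_mul _ (by fun_prop)).symm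
    _ ≤ ∫⁻ x, h x := by
        refine lintegral_mono fun x => ?_
        calc M * min (h x / M) 1 ≤ M * (h x / M) := by gcongr; exact min_le_left _ _
          _ = h x := ENNReal.mul_div_cancel hM0 hMt

/-- The Prékopa–Leindler inequality on the line. -/
theorem prekopa_leindler_real {f g h : ℝ → ℝ≥0∞} {a b : ℝ} (ha : 0 < a) (hb : 0 < b)
    (hab : a + b = 1) (hf : Measurable f) (hg : Measurable g) (hh : Measurable h)
    (hfg : ∀ x y, f x ^ a * g y ^ b ≤ h (a * x + b * y)) :
    (∫⁻ x, f x) ^ a * (∫⁻ x, g x) ^ b ≤ ∫⁻ x, h x := by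
  -- Zero integrals are set aside because multiplication in `ℝ≥0∞` is discontinuous at (0, ∞), which
  -- would break the truncation limit below.
  rcases eq_or_ne (∫⁻ x, f x) 0 with hf0 | hf0
  · simp [hf0, ha]
  rcases eq_or_ne (∫⁻ x, g x) 0 with hg0 | hg0
  · simp [hg0, hb]
  have hlim : ∀ u : ℝ → ℝ≥0∞, Measurable u →
      Tendsto (fun n : ℕ => ∫⁻ x, min (u x) n) atTop (𝓝 (∫⁻ x, u x)) := by
    intro u hu
    refine lintegral_tendsto_of_tendsto_of_monotone (fun n => by fun_prop)
      (ae_of_all _ fun x m n hmn => min_le_min le_rfl (by exact_mod_cast hmn))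
      (ae_of_all _ fun x => ?_)
    have := (tendsto_const_nhds (x := u x)).min ENNReal.tendsto_nat_nhds_top
    simpa using this
  refine le_of_tendsto' (ENNReal.Tendsto.mul ((hlim f hf).ennrpow_const a) (Or.inl ?_)
    ((hlim g hg).ennrpow_const b) (Or.inl ?_)) fun n => ?_
  · simp [hf0, ha.not_gt]
  · simp [hg0, hb.not_gt]
  · refine prekopa_leindler_real_of_bounded ha hb hab (by fun_prop) (by fun_prop) hh ?_ ?_ ?_
    · exact ne_top_of_le_ne_top (ENNReal.natCast_ne_top n) (iSup_le fun x => min_le_right _ _)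
    · exact ne_top_of_le_ne_top (ENNReal.natCast_ne_top n) (iSup_le fun x => min_le_right _ _)
    · intro x y
      refine le_trans ?_ (hfg x y)
      gcongr <;> exact min_le_left _ _

/-- The Prékopa–Leindler inequality. -/
theorem prekopa_leindler_pi {n : ℕ} {f g h : (Fin n → ℝ) → ℝ≥0∞} {a b : ℝ} (ha : 0 < a)
    (hb : 0 < b) (hab : a + b = 1) (hf : Measurable f) (hg : Measurable g) (hh : Measurable h)
    (hfg : ∀ x y, f x ^ a * g y ^ b ≤ h (a • x + b • y)) :
    (∫⁻ x, f x) ^ a * (∫⁻ x, g x) ^ b ≤ ∫⁻ x, h x := by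
  induction n with
  | zero =>
    have := hfg 0 0
    simpa [volume_pi, Measure.pi_of_empty (fun _ : Fin 0 => (volume : Measure ℝ)) 0,
      lintegral_dirac] using this
  | succ n ih =>
    have e := (volume_preserving_piFinSuccAbove (fun _ : Fin (n + 1) => ℝ) 0).symm
    have fub : ∀ u : (Fin (n + 1) → ℝ) → ℝ≥0∞, Measurable u →
        ∫⁻ x, u x = ∫⁻ s : ℝ, ∫⁻ y : Fin n → ℝ, u (Fin.cons s y) := by
      intro u hu
      rw [← e.lintegral_comp hu, Measure.volume_eq_prod, lintegral_prod _ (by fun_prop)]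
      simp [MeasurableEquiv.piFinSuccAbove, Fin.insertNthEquiv, Fin.insertNth_zero']
    have hcons : Measurable fun p : ℝ × (Fin n → ℝ) => (Fin.cons p.1 p.2 : Fin (n + 1) → ℝ) :=
      by simpa [MeasurableEquiv.piFinSuccAbove, Fin.insertNthEquiv, Fin.insertNth_zero', Function.comp_def] using! e.measurable
    have hmeas : ∀ u : (Fin (n + 1) → ℝ) → ℝ≥0∞, Measurable u →
        Measurable fun s : ℝ => ∫⁻ y : Fin n → ℝ, u (Fin.cons s y) := fun u hu =>
      (hu.comp hcons).lintegral_prod_right'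
    have hslice : ∀ u : (Fin (n + 1) → ℝ) → ℝ≥0∞, Measurable u → ∀ s : ℝ,
        Measurable fun y : Fin n → ℝ => u (Fin.cons s y) := fun u hu s =>
      (hu.comp hcons).comp measurable_prodMk_left
    rw [fub f hf, fub g hg, fub h hh]
    -- The slice integrals satisfy the one-dimensional hypothesis, by the induction hypothesis on
    -- slices.
    refine prekopa_leindler_real ha hb hab (hmeas f hf) (hmeas g hg) (hmeas h hh) fun s t => ?_
    refine ih (hslice f hf s) (hslice g hg t) (hslice h hh _) fun x y => ?_
    refine (hfg _ _).trans (le_of_eq (congrArg h ?_))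
    ext i
    refine Fin.cases ?_ (fun j => ?_) i <;> simp

theorem prekopa_leindler {n : ℕ} {f g h : EuclideanSpace ℝ (Fin n) → ℝ≥0∞} {a b : ℝ} (ha : 0 < a)
    (hb : 0 < b) (hab : a + b = 1) (hf : Measurable f) (hg : Measurable g) (hh : Measurable h)
    (hfg : ∀ x y, f x ^ a * g y ^ b ≤ h (a • x + b • y)) :
    (∫⁻ x, f x) ^ a * (∫⁻ x, g x) ^ b ≤ ∫⁻ x, h x := by
  have e := PiLp.volume_preserving_toLp (Fin n)
  rw [← e.lintegral_comp hf, ← e.lintegral_comp hg, ← e.lintegral_comp hh]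
  exact prekopa_leindler_pi ha hb hab (hf.comp e.measurable) (hg.comp e.measurable)
    (hh.comp e.measurable) fun x y => hfg _ _

/-! ### Log-concave tails and anti-concentration -/

/-- Prékopa–Leindler for the density times halfspace indicators. The mix of ≤ and < is chosen so
that later {-ε ≤ Y} minus {ε < Y} is exactly {|Y| ≤ ε}. -/
theorem IsLogConcave.rpow_mul_rpow_le {d : ℕ} {ν : Measure (EuclideanSpace ℝ (Fin d))}
    (hν : IsLogConcave ν) (w : EuclideanSpace ℝ (Fin d)) {a b : ℝ} (ha : 0 < a) (hb : 0 < b)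
    (hab : a + b = 1) (s t : ℝ) :
    ν {x | s ≤ ⟪w, x⟫} ^ a * ν {x | t < ⟪w, x⟫} ^ b ≤ ν {x | a * s + b * t < ⟪w, x⟫} := by
  obtain ⟨f, hf, ⟨hf0, hfc⟩, rfl⟩ := hν
  have hin : Measurable fun x : EuclideanSpace ℝ (Fin d) => ⟪w, x⟫ := by fun_prop
  have m1 : MeasurableSet {x | s ≤ ⟪w, x⟫} := measurableSet_le measurable_const hin
  have m2 : ∀ t : ℝ, MeasurableSet {x | t < ⟪w, x⟫} := fun t =>
    measurableSet_lt measurable_const hin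
  rw [withDensity_apply _ m1, withDensity_apply _ (m2 _), withDensity_apply _ (m2 _),
    ← lintegral_indicator m1, ← lintegral_indicator (m2 _), ← lintegral_indicator (m2 _)]
  refine prekopa_leindler ha hb hab (hf.ennreal_ofReal.indicator m1)
    (hf.ennreal_ofReal.indicator (m2 _)) (hf.ennreal_ofReal.indicator (m2 _)) fun x y => ?_
  by_cases hx : s ≤ ⟪w, x⟫
  · by_cases hy : t < ⟪w, y⟫
    · have hxy : a * s + b * t < ⟪w, a • x + b • y⟫ := by
        rw [inner_add_right, real_inner_smul_right, real_inner_smul_right]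
        have := mul_le_mul_of_nonneg_left hx ha.le
        have := mul_lt_mul_of_pos_left hy hb
        linarith
      rw [indicator_of_mem (by exact hx), indicator_of_mem (by exact hy),
        indicator_of_mem (by exact hxy), ENNReal.ofReal_rpow_of_nonneg (hf0 x) ha.le,
        ENNReal.ofReal_rpow_of_nonneg (hf0 y) hb.le,
        ← ENNReal.ofReal_mul (Real.rpow_nonneg (hf0 x) a)]
      exact ENNReal.ofReal_le_ofReal (hfc x y a b ha.le hb.le hab)
    · rw [indicator_of_notMem (s := {x | t < ⟪w, x⟫}) (a := y) (by exact hy)]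
      simp [hb]
  · rw [indicator_of_notMem (s := {x | s ≤ ⟪w, x⟫}) (a := x) (by exact hx)]
    simp [ha]

section Real

variable {Ω : Type*} [MeasurableSpace Ω] {ν : Measure Ω} [IsProbabilityMeasure ν] {Y : Ω → ℝ}

/-- The upper tails of `Y` are log-concave. -/
def HasLogConcaveTail (ν : Measure Ω) (Y : Ω → ℝ) : Prop :=
  ∀ a b s t : ℝ, 0 < a → 0 < b → a + b = 1 →
    ν {x | s ≤ Y x} ^ a * ν {x | t < Y x} ^ b ≤ ν {x | a * s + b * t < Y x}

/-- Between -ε and ε the tail drops from A to B = A - p, so its logarithm falls by at least p over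
length 2ε. Concavity of the logarithm preserves at least that slope beyond ε. -/
theorem HasLogConcaveTail.measureReal_le_exp (h : HasLogConcaveTail ν Y) (hY : Measurable Y)
    {ε t : ℝ} (hε : 0 < ε) (ht : 0 < t) :
    ν.real {x | t < Y x - ε} ≤ Real.exp (-(ν.real {x | |Y x| ≤ ε} / (2 * ε) * t)) := by
  set A := ν.real {x | -ε ≤ Y x}
  set B := ν.real {x | ε < Y x}
  set p := ν.real {x | |Y x| ≤ ε}
  have hset : {x | t < Y x - ε} = {x | ε + t < Y x} := by
    ext x; simp only [mem_ofPred_eq, lt_sub_iff_add_lt']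
  rw [hset]
  set C := ν.real {x | ε + t < Y x}
  have hAB : A = p + B := by
    have hdisj : Disjoint {x | |Y x| ≤ ε} {x | ε < Y x} :=
      disjoint_left.2 fun x (h1 : |Y x| ≤ ε) (h2 : ε < Y x) =>
        absurd (le_abs_self (Y x)) (by linarith)
    rw [← measureReal_union hdisj (measurableSet_lt measurable_const hY)]
    refine congrArg ν.real (Set.ext fun x => ?_)
    simp only [mem_ofPred_eq, mem_union, abs_le]
    constructor
    · intro h1
      rcases le_or_gt (Y x) ε with h2 | h2
      exacts [Or.inl ⟨h1, h2⟩, Or.inr h2]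
    · rintro (h1 | h1)
      exacts [h1.1, by linarith]
  have hden : 0 < 2 * ε + t := by positivity
  -- These weights write ε as a(-ε) + b(ε + t).
  set a := t / (2 * ε + t)
  set b := 2 * ε / (2 * ε + t) with hb
  have ha0 : 0 < a := by positivity
  have hb0 : 0 < b := by positivity
  have hab : a + b = 1 := by simp only [a, b]; field_simp; ring
  have key : A ^ a * C ^ b ≤ B := by
    have h1 := h a b (-ε) (ε + t) ha0 hb0 hab
    have h2 : a * (-ε) + b * (ε + t) = ε := by simp only [a, b]; field_simp; ring
    rw [h2] at h1
    have h3 := ENNReal.toReal_mono (measure_ne_top _ _) h1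
    rwa [ENNReal.toReal_mul, ← ENNReal.toReal_rpow, ← ENNReal.toReal_rpow] at h3
  have hA1 : A ≤ 1 := measureReal_le_one
  have hp0 : 0 ≤ p := measureReal_nonneg
  rcases (measureReal_nonneg : 0 ≤ C).eq_or_lt with hC | hC
  · exact hC.symm.trans_le (Real.exp_pos _).le
  have hCB : C ≤ B := measureReal_mono fun x (hx : ε + t < Y x) => show ε < Y x by linarith
  have hB : 0 < B := hC.trans_le hCB
  have hA : 0 < A := by linarith
  rw [← Real.log_le_iff_le_exp hC]
  have hlog := Real.log_le_log (by positivity) key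
  rw [Real.log_mul (by positivity) (by positivity), Real.log_rpow hA, Real.log_rpow hC] at hlog
  have h1 : Real.log B - Real.log A ≤ -p := by
    rw [← Real.log_div hB.ne' hA.ne']
    refine (Real.log_le_sub_one_of_pos (by positivity)).trans ?_
    rw [div_sub_one hA.ne', div_le_iff₀ hA]
    nlinarith
  have h2 : Real.log A ≤ 0 := Real.log_nonpos hA.le hA1
  have h3 : b * Real.log C ≤ -p := by
    have : a = 1 - b := by linarith
    rw [this] at hlog
    nlinarith
  have h4 : Real.log C ≤ -p / b := by rw [le_div_iff₀ hb0]; linarith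
  refine h4.trans ?_
  rw [hb, neg_div, neg_le_neg_iff, div_div_eq_mul_div, div_mul_eq_mul_div]
  gcongr
  linarith

theorem lintegral_mul_exp_neg_Ioi {r : ℝ} (hr : 0 < r) :
    ∫⁻ t in Ioi (0 : ℝ), ENNReal.ofReal (Real.exp (-(r * t)) * t) = ENNReal.ofReal ((1 / r) ^ 2) := by
  have h := Real.integral_rpow_mul_exp_neg_mul_Ioi (a := 2) (r := r) (by norm_num) hr
  have h' : ∫ t in Ioi (0 : ℝ), Real.exp (-(r * t)) * t = (1 / r) ^ 2 := by
    rw [Real.Gamma_two, mul_one] at h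
    rw [← Real.rpow_natCast, Nat.cast_ofNat, ← h]
    refine setIntegral_congr_fun measurableSet_Ioi fun t _ => ?_
    norm_num [mul_comm]
  rw [← h', ofReal_integral_eq_lintegral_ofReal]
  · exact Not.imp_symm integral_undef (by rw [h']; positivity)
  · filter_upwards [ae_restrict_mem measurableSet_Ioi] with t (ht : 0 < t)
    positivity

theorem HasLogConcaveTail.lintegral_excess_sq_le (h : HasLogConcaveTail ν Y) (hY : Measurable Y)
    {ε : ℝ} (hε : 0 < ε) (hp : 0 < ν.real {x | |Y x| ≤ ε}) :
    ∫⁻ x, ENNReal.ofReal (max (Y x - ε) 0 ^ 2) ∂ν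
      ≤ ENNReal.ofReal (2 * (2 * ε / ν.real {x | |Y x| ≤ ε}) ^ 2) := by
  set p := ν.real {x | |Y x| ≤ ε} with hpdef
  have hr : 0 < p / (2 * ε) := by positivity
  have hl := lintegral_rpow_eq_lintegral_meas_lt_mul ν (f := fun x => max (Y x - ε) 0)
    (ae_of_all _ fun x => le_max_right _ _) (by fun_prop) (p := 2) two_pos
  simp only [Real.rpow_two] at hl
  rw [hl, ENNReal.ofReal_mul two_pos.le]
  gcongr
  have : (2 * ε / p) = 1 / (p / (2 * ε)) := by simp
  rw [this, ← lintegral_mul_exp_neg_Ioi hr]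
  refine setLIntegral_mono (by fun_prop) fun t (ht : 0 < t) => ?_
  have e1 : {x | t < max (Y x - ε) 0} = {x | t < Y x - ε} := by
    ext x; simp [ht.not_gt]
  rw [e1, ENNReal.ofReal_mul (Real.exp_pos _).le]
  have e2 : t ^ ((2 : ℝ) - 1) = t := by norm_num
  rw [e2]
  gcongr
  rw [← ofReal_measureReal]
  exact ENNReal.ofReal_le_ofReal (h.measureReal_le_exp hY hε ht)

/-- Anti-concentration of a real random variable of unit second moment with log-concave tails. -/
theorem HasLogConcaveTail.measureReal_abs_le (h : HasLogConcaveTail ν Y)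
    (h' : HasLogConcaveTail ν (fun x => -Y x)) (hY : Measurable Y)
    (hY2 : ∫ x, Y x ^ 2 ∂ν = 1) {ε : ℝ} (hε : 0 < ε) :
    ν.real {x | |Y x| ≤ ε} ≤ 6 * ε := by
  rcases (measureReal_nonneg : 0 ≤ ν.real {x | |Y x| ≤ ε}).eq_or_lt with hp | hp
  · rw [← hp]; positivity
  have h1 := h.lintegral_excess_sq_le hY hε hp
  have h2 := h'.lintegral_excess_sq_le hY.neg hε (by simpa only [abs_neg] using hp)
  simp only [abs_neg] at h2
  set p := ν.real {x | |Y x| ≤ ε}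
  have hint : Integrable (fun x => Y x ^ 2) ν :=
    Not.imp_symm integral_undef (by rw [hY2]; exact one_ne_zero)
  have h3 : (1 : ℝ≥0∞) ≤ ENNReal.ofReal
      (2 * ε ^ 2 + 2 * (2 * (2 * ε / p) ^ 2) + 2 * (2 * (2 * ε / p) ^ 2)) := by
    rw [← ENNReal.ofReal_one, ← hY2,
      ofReal_integral_eq_lintegral_ofReal hint (ae_of_all _ fun x => sq_nonneg _)]
    calc ∫⁻ x, ENNReal.ofReal (Y x ^ 2) ∂ν
        ≤ ∫⁻ x, ENNReal.ofReal (2 * ε ^ 2) + ENNReal.ofReal 2 * ENNReal.ofReal (max (Y x - ε) 0 ^ 2)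
            + ENNReal.ofReal 2 * ENNReal.ofReal (max (-Y x - ε) 0 ^ 2) ∂ν := by
          refine lintegral_mono fun x => ?_
          rw [← ENNReal.ofReal_mul two_pos.le, ← ENNReal.ofReal_mul two_pos.le,
            ← ENNReal.ofReal_add (by positivity) (by positivity),
            ← ENNReal.ofReal_add (by positivity) (by positivity)]
          refine ENNReal.ofReal_le_ofReal ?_
          rcases max_cases (Y x - ε) 0 with ⟨e, _⟩ | ⟨e, _⟩ <;>
          rcases max_cases (-Y x - ε) 0 with ⟨e', _⟩ | ⟨e', _⟩ <;> rw [e, e'] <;>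
          nlinarith [sq_nonneg (Y x - 2 * ε), sq_nonneg (Y x + 2 * ε)]
      _ ≤ _ := by
          rw [lintegral_add_left (by fun_prop), lintegral_add_left (by fun_prop),
            lintegral_const_mul _ (by fun_prop), lintegral_const_mul _ (by fun_prop),
            ENNReal.ofReal_add (by positivity) (by positivity),
            ENNReal.ofReal_add (by positivity) (by positivity), lintegral_const, measure_univ,
            mul_one, ENNReal.ofReal_mul (p := 2) (q := 2 * (2 * ε / p) ^ 2) two_pos.le]
          gcongr
  have h4 := ENNReal.one_le_ofReal.1 h3
  have hp1 : p ≤ 1 := measureReal_le_one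
  -- With p ≤ 1 the moment bound gives p² ≤ 34ε² ≤ (6ε)².
  refine le_of_sq_le_sq ?_ (by positivity)
  have h5 : p ^ 2 ≤ 2 * ε ^ 2 * p ^ 2 + 32 * ε ^ 2 := by
    have := mul_le_mul_of_nonneg_right h4 (sq_nonneg p)
    rw [one_mul] at this
    refine this.trans (le_of_eq ?_)
    field_simp
    ring
  nlinarith [sq_nonneg ε, mul_le_mul_of_nonneg_left (pow_le_one₀ hp.le hp1 (n := 2)) (sq_nonneg ε)]

/-- A centred random variable of unit variance that is not concentrated near the origin
is nonnegative with probability bounded below. -/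
theorem measureReal_nonneg_ge {Z : Ω → ℝ} (hZ : Measurable Z) (hZi : Integrable Z ν)
    (hZ0 : ∫ x, Z x ∂ν = 0) (hZ2 : ∫ x, Z x ^ 2 ∂ν = 1)
    (hsmall : ∀ ε > 0, ν.real {x | |Z x| ≤ ε} ≤ 6 * ε) :
    1 / 2304 ≤ ν.real {x | 0 ≤ Z x} := by
  have hint : Integrable (fun x => Z x ^ 2) ν :=
    Not.imp_symm integral_undef (by rw [hZ2]; exact one_ne_zero)
  have hS : MeasurableSet {x | 0 ≤ Z x} := measurableSet_le measurable_const hZ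
  have h1 : 1 / 24 ≤ ∫ x, |Z x| ∂ν := by
    have h2 := mul_meas_ge_le_integral_of_nonneg (ae_of_all _ fun x => abs_nonneg (Z x)) hZi.abs
      (1 / 12)
    have h3 : 1 ≤ ν.real {x | 1 / 12 ≤ |Z x|} + ν.real {x | |Z x| ≤ 1 / 12} := by
      refine le_trans (le_of_eq ?_) (measureReal_union_le _ _)
      rw [← probReal_univ (μ := ν)]
      refine congrArg _ (Set.ext fun x => ?_)
      simpa using le_total _ _
    have := hsmall (1 / 12) (by norm_num)
    linarith
  -- On Z ≥ 0 this is AM–GM, 2Z ≤ Z²/48 + 48. As E Z = 0, the left side is E|Z| ≥ 1/24, leaving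
  -- (1/48)/48 = 1/2304 for the probability.
  have h2 : ∫ x, (|Z x| + Z x) ∂ν
      ≤ ∫ x, (1 / 48 * Z x ^ 2 + 48 * {x | 0 ≤ Z x}.indicator (fun _ => (1 : ℝ)) x) ∂ν := by
    refine integral_mono (hZi.abs.add hZi) ((hint.const_mul _).add
      (((integrable_const _).indicator hS).const_mul _)) fun x => ?_
    by_cases hx : 0 ≤ Z x
    · simp only [abs_of_nonneg hx, indicator_of_mem (show x ∈ {x | 0 ≤ Z x} from hx)]
      nlinarith [sq_nonneg (Z x - 48)]
    · simp only [abs_of_neg (not_le.1 hx),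
        indicator_of_notMem (show x ∉ {x | 0 ≤ Z x} from hx)]
      nlinarith [sq_nonneg (Z x)]
  rw [integral_add hZi.abs hZi, integral_add (hint.const_mul _)
    (((integrable_const _).indicator hS).const_mul _), integral_const_mul, integral_const_mul,
    hZ0, hZ2, integral_indicator_const _ hS] at h2
  simp only [smul_eq_mul, mul_one] at h2
  linarith

/-- The constant in `integral_indicator_sq_ge`. -/
noncomputable def halfspaceConst : ℝ := (1 / 27648) ^ 2 / 4608

theorem halfspaceConst_pos : 0 < halfspaceConst := by norm_num [halfspaceConst]

/-- The cutoff δ = 1/27648 makes 6δ = 1/4608, half the guaranteed mass of S. Hence |Y| > δ on at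
least the other half of that mass. -/
theorem integral_indicator_sq_ge (hY : Measurable Y) (hY2 : Integrable (fun x => Y x ^ 2) ν)
    (hsmall : ∀ ε > 0, ν.real {x | |Y x| ≤ ε} ≤ 6 * ε) {S : Set Ω} (hS : MeasurableSet S)
    (hνS : 1 / 2304 ≤ ν.real S) :
    halfspaceConst ≤ ∫ x, S.indicator (fun x => Y x ^ 2) x ∂ν := by
  have hT : MeasurableSet {x | |Y x| ≤ 1 / 27648} := measurableSet_le hY.abs measurable_const
  have iS : Integrable (S.indicator fun _ => (1 : ℝ)) ν := (integrable_const _).indicator hS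
  have iT : Integrable ({x | |Y x| ≤ 1 / 27648}.indicator fun _ => (1 : ℝ)) ν :=
    (integrable_const _).indicator hT
  have h1 : ∫ x, (1 / 27648) ^ 2 * (S.indicator (fun _ => (1 : ℝ)) x
        - {x | |Y x| ≤ 1 / 27648}.indicator (fun _ => (1 : ℝ)) x) ∂ν
      ≤ ∫ x, S.indicator (fun x => Y x ^ 2) x ∂ν := by
    refine integral_mono ((iS.sub iT).const_mul _) (hY2.indicator hS) fun x => ?_
    by_cases hx : x ∈ S <;> by_cases hx' : |Y x| ≤ 1 / 27648
    · simp only [indicator_of_mem hx, indicator_of_mem (show x ∈ {x | |Y x| ≤ 1 / 27648} from hx')]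
      nlinarith [sq_nonneg (Y x)]
    · simp only [indicator_of_mem hx,
        indicator_of_notMem (show x ∉ {x | |Y x| ≤ 1 / 27648} from hx')]
      rw [← sq_abs (Y x)]
      nlinarith
    · simp only [indicator_of_notMem hx,
        indicator_of_mem (show x ∈ {x | |Y x| ≤ 1 / 27648} from hx')]
      norm_num
    · simp only [indicator_of_notMem hx,
        indicator_of_notMem (show x ∉ {x | |Y x| ≤ 1 / 27648} from hx')]
      norm_num
  rw [integral_const_mul, integral_sub iS iT, integral_indicator_const _ hS,
    integral_indicator_const _ hT] at h1
  have := hsmall (1 / 27648) (by norm_num)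
  simp only [smul_eq_mul, mul_one] at h1
  refine le_trans ?_ h1
  rw [halfspaceConst, div_eq_mul_inv]
  gcongr
  linarith

end Real

/-! ### Second moments of isotropic distributions on halfspaces -/

section Isotropic

variable {d : ℕ} {ν : Measure (EuclideanSpace ℝ (Fin d))}

theorem IsIsotropic.memLp (h : IsIsotropic ν) : MemLp (fun x => x) 2 ν := by
  rw [memLp_two_iff_integrable_sq_norm (by fun_prop)]
  simp only [EuclideanSpace.real_norm_sq_eq]
  -- A non-integrable function has integral 0 by convention, so a diagonal moment equal to 1 forces
  -- integrability.
  refine integrable_finsetSum _ fun i _ => Not.imp_symm integral_undef ?_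
  have := h.2 i i
  simp only [← sq, Matrix.one_apply_eq] at this
  rw [this]; exact one_ne_zero

theorem IsIsotropic.memLp_inner (h : IsIsotropic ν) (w : EuclideanSpace ℝ (Fin d)) :
    MemLp (fun x => ⟪w, x⟫) 2 ν :=
  h.memLp.const_inner w

theorem IsIsotropic.integral_inner_eq_zero [IsProbabilityMeasure ν] (h : IsIsotropic ν)
    (w : EuclideanSpace ℝ (Fin d)) : ∫ x, ⟪w, x⟫ ∂ν = 0 := by
  rw [integral_inner (h.memLp.integrable one_le_two) w, h.1, inner_zero_right]

theorem IsIsotropic.integral_inner_sq (h : IsIsotropic ν) (w : EuclideanSpace ℝ (Fin d)) :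
    ∫ x, ⟪w, x⟫ ^ 2 ∂ν = ‖w‖ ^ 2 := by
  have hi : ∀ i, MemLp (fun x : EuclideanSpace ℝ (Fin d) => x i) 2 ν := fun i => by
    simpa [EuclideanSpace.inner_single_left] using h.memLp_inner (EuclideanSpace.single i 1)
  have hij : ∀ i j, Integrable (fun x : EuclideanSpace ℝ (Fin d) => w i * w j * (x i * x j)) ν :=
    fun i j => ((hi i).integrable_mul (hi j)).const_mul _
  have e : ∀ x : EuclideanSpace ℝ (Fin d), ⟪w, x⟫ ^ 2 = ∑ i, ∑ j, w i * w j * (x i * x j) := by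
    intro x
    rw [PiLp.inner_apply, sq, Finset.sum_mul_sum]
    refine Finset.sum_congr rfl fun i _ => Finset.sum_congr rfl fun j _ => ?_
    simp only [RCLike.inner_apply, conj_trivial]
    ring
  simp only [e]
  rw [integral_finsetSum _ fun i _ => integrable_finsetSum _ fun j _ => hij i j]
  simp_rw [integral_finsetSum _ fun j _ => hij _ j, integral_const_mul, h.2]
  simp [Matrix.one_apply, EuclideanSpace.real_norm_sq_eq, ← sq]

variable [IsProbabilityMeasure ν]

theorem IsLogConcave.measureReal_abs_inner_le (h : IsIsotropic ν) (hc : IsLogConcave ν)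
    {w : EuclideanSpace ℝ (Fin d)} (hw : ‖w‖ = 1) {ε : ℝ} (hε : 0 < ε) :
    ν.real {x | |⟪w, x⟫| ≤ ε} ≤ 6 * ε := by
  refine HasLogConcaveTail.measureReal_abs_le
    (fun a b s t ha hb hab => hc.rpow_mul_rpow_le w ha hb hab s t) ?_ (by fun_prop)
    (by rw [h.integral_inner_sq, hw, one_pow]) hε
  intro a b s t ha hb hab
  simpa only [inner_neg_left] using hc.rpow_mul_rpow_le (-w) ha hb hab s t

/-- Every halfspace through the origin carries a constant fraction of the second moment in
every direction. -/
theorem IsLogConcave.integral_indicator_inner_sq_ge (h : IsIsotropic ν) (hc : IsLogConcave ν)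
    (w z : EuclideanSpace ℝ (Fin d)) :
    halfspaceConst * ‖w‖ ^ 2 ≤ ∫ x, {x | 0 ≤ ⟪z, x⟫}.indicator (fun x => ⟪w, x⟫ ^ 2) x ∂ν := by
  rcases eq_or_ne w 0 with rfl | hw
  · simp
  have hw' : 0 < ‖w‖ := norm_pos_iff.2 hw
  have hS : MeasurableSet {x : EuclideanSpace ℝ (Fin d) | 0 ≤ ⟪z, x⟫} :=
    measurableSet_le measurable_const (by fun_prop)
  have hνS : 1 / 2304 ≤ ν.real {x | 0 ≤ ⟪z, x⟫} := by
    rcases eq_or_ne z 0 with rfl | hz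
    · norm_num
    have hz' : 0 < ‖z‖ := norm_pos_iff.2 hz
    have hu : ‖‖z‖⁻¹ • z‖ = 1 := norm_smul_inv_norm (𝕜 := ℝ) hz
    have := measureReal_nonneg_ge (ν := ν) (Z := fun x => ⟪‖z‖⁻¹ • z, x⟫) (by fun_prop)
      ((h.memLp_inner _).integrable one_le_two) (h.integral_inner_eq_zero _)
      (by rw [h.integral_inner_sq, hu, one_pow]) (fun ε hε => hc.measureReal_abs_inner_le h hu hε)
    simpa only [real_inner_smul_left, mul_nonneg_iff_of_pos_left (inv_pos.2 hz')] using this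
  have hu : ‖‖w‖⁻¹ • w‖ = 1 := norm_smul_inv_norm (𝕜 := ℝ) hw
  have key := integral_indicator_sq_ge (ν := ν) (Y := fun x => ⟪‖w‖⁻¹ • w, x⟫) (by fun_prop)
    (h.memLp_inner _).integrable_sq (fun ε hε => hc.measureReal_abs_inner_le h hu hε) hS hνS
  have e : ∀ x, {x | 0 ≤ ⟪z, x⟫}.indicator (fun x => ⟪w, x⟫ ^ 2) x
      = ‖w‖ ^ 2 * {x | 0 ≤ ⟪z, x⟫}.indicator (fun x => ⟪‖w‖⁻¹ • w, x⟫ ^ 2) x := by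
    intro x
    by_cases hx : 0 ≤ ⟪z, x⟫
    · rw [indicator_of_mem (by exact hx), indicator_of_mem (by exact hx), real_inner_smul_left]
      field_simp
    · rw [indicator_of_notMem (by exact hx), indicator_of_notMem (by exact hx), mul_zero]
  simp_rw [e]
  rw [integral_const_mul, mul_comm]
  gcongr

end Isotropic

/-! ### ReLU, its primitive and the Bregman bound -/

theorem continuous_relu : Continuous relu := by
  unfold relu; fun_prop

theorem relu_of_nonneg {a : ℝ} (h : 0 ≤ a) : relu a = a := max_eq_right h

theorem relu_of_nonpos {a : ℝ} (h : a ≤ 0) : relu a = 0 := max_eq_left h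

theorem abs_relu_le (a : ℝ) : |relu a| ≤ |a| := by
  rcases le_total 0 a with h | h
  · rw [relu_of_nonneg h]
  · rw [relu_of_nonpos h, abs_zero]; exact abs_nonneg a

theorem integral_relu_sub (c y : ℝ) :
    ∫ a in (0 : ℝ)..c, (relu a - y) = relu c ^ 2 / 2 - y * c := by
  rw [intervalIntegral.integral_sub (continuous_relu.intervalIntegrable _ _)
    intervalIntegrable_const, intervalIntegral.integral_const]
  have : ∫ a in (0 : ℝ)..c, relu a = relu c ^ 2 / 2 := by
    rcases le_total 0 c with h | h
    · rw [intervalIntegral.integral_congr (g := fun a => a), integral_id, relu_of_nonneg h]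
      · ring
      · intro a ha
        rw [uIcc_of_le h] at ha
        exact relu_of_nonneg ha.1
    · rw [intervalIntegral.integral_congr (g := fun _ => 0), intervalIntegral.integral_zero,
        relu_of_nonpos h]
      · norm_num
      · intro a ha
        rw [uIcc_of_ge h] at ha
        exact relu_of_nonpos ha.2
  rw [this, smul_eq_mul]
  ring

/-- A lower bound for the Bregman divergence of the primitive `relu ^ 2 / 2` of `relu`. -/
theorem relu_bregman_ge {p q : ℝ} :
    relu q * (p - q) + (if 0 ≤ p + q then (p - q) ^ 2 else 0) / 8
      ≤ relu p ^ 2 / 2 - relu q ^ 2 / 2 := by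
  -- The factor 1/8 is attained at q = -p ≤ 0.
  rcases le_total 0 p with hp | hp <;> rcases le_total 0 q with hq | hq <;>
  simp only [relu_of_nonneg, relu_of_nonpos, hp, hq] <;> split_ifs with h
  · nlinarith [sq_nonneg (p - q)]
  · nlinarith [sq_nonneg (p - q)]
  · nlinarith [mul_nonneg h (by linarith : 0 ≤ 3 * p - q)]
  · nlinarith [sq_nonneg p]
  · nlinarith [mul_nonneg h (by linarith : 0 ≤ q - p), mul_nonneg hq (neg_nonneg.2 hp)]
  · nlinarith [sq_nonneg q, mul_nonneg hq (neg_nonneg.2 hp)]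
  · obtain rfl : p = 0 := by linarith
    obtain rfl : q = 0 := by linarith
    norm_num
  · norm_num

section

variable {d : ℕ} {ν : Measure (EuclideanSpace ℝ (Fin d))}

theorem IsIsotropic.memLp_relu_inner (h : IsIsotropic ν) (w : EuclideanSpace ℝ (Fin d)) :
    MemLp (fun x => relu ⟪w, x⟫) 2 ν := by
  refine (h.memLp_inner w).mono
    (continuous_relu.comp (continuous_const.inner continuous_id)).aestronglyMeasurable
    (ae_of_all _ fun x => abs_relu_le _)

theorem IsIsotropic.inner_chow {D : Measure (EuclideanSpace ℝ (Fin d) × ℝ)}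
    (h : IsIsotropic D.fst) (u w : EuclideanSpace ℝ (Fin d)) :
    ⟪chow D (glm relu u), w⟫ = ∫ x, relu ⟪u, x⟫ * ⟪w, x⟫ ∂D.fst := by
  have hi : Integrable (fun x => relu ⟪u, x⟫ • x) D.fst :=
    h.memLp.smul (h.memLp_relu_inner u) |> memLp_one_iff_integrable.1
  rw [real_inner_comm, chow]
  simp only [glm]
  rw [← integral_inner hi]
  simp only [real_inner_smul_right]

theorem IsLogConcave.integral_relu_sq_ge [IsProbabilityMeasure ν] (h : IsIsotropic ν)
    (hc : IsLogConcave ν) (u z : EuclideanSpace ℝ (Fin d)) :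
    ∫ x, relu ⟪z, x⟫ * ⟪u - z, x⟫ ∂ν + halfspaceConst * ‖u - z‖ ^ 2 / 8
      ≤ ∫ x, relu ⟪u, x⟫ ^ 2 / 2 ∂ν - ∫ x, relu ⟪z, x⟫ ^ 2 / 2 ∂ν := by
  have hS : MeasurableSet {x : EuclideanSpace ℝ (Fin d) | 0 ≤ ⟪u + z, x⟫} :=
    measurableSet_le measurable_const (by fun_prop)
  have i1 : Integrable (fun x => relu ⟪z, x⟫ * ⟪u - z, x⟫) ν :=
    (h.memLp_relu_inner z).integrable_mul (h.memLp_inner _)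
  have i2 : Integrable (fun x => {x | 0 ≤ ⟪u + z, x⟫}.indicator (fun x => ⟪u - z, x⟫ ^ 2) x / 8) ν :=
    ((h.memLp_inner _).integrable_sq.indicator hS).div_const _
  have i3 : ∀ w, Integrable (fun x => relu ⟪w, x⟫ ^ 2 / 2) ν := fun w =>
    (h.memLp_relu_inner w).integrable_sq.div_const _
  calc _ ≤ ∫ x, relu ⟪z, x⟫ * ⟪u - z, x⟫ ∂ν
        + ∫ x, {x | 0 ≤ ⟪u + z, x⟫}.indicator (fun x => ⟪u - z, x⟫ ^ 2) x / 8 ∂ν := by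
        rw [integral_div]
        gcongr
        exact hc.integral_indicator_inner_sq_ge h _ _
    _ ≤ _ := by
        rw [← integral_add i1 i2, ← integral_sub (i3 u) (i3 z)]
        refine integral_mono (i1.add i2) ((i3 u).sub (i3 z)) fun x => ?_
        have := relu_bregman_ge (p := ⟪u, x⟫) (q := ⟪z, x⟫)
        simp only [indicator_apply, mem_ofPred_eq, inner_add_left, inner_sub_left]
        exact this

end

/-! ### Strong convexity -/

section

variable {d : ℕ} {D : Measure (EuclideanSpace ℝ (Fin d) × ℝ)}

/-- Adding the Bregman bounds for (u, v) and (v, u) cancels F and doubles the constant 1/8 to 1/4.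
-/
theorem satisfiesStrongConvexity_relu [IsProbabilityMeasure D]
    (h : IsIsotropic D.fst) (hc : IsLogConcave D.fst) :
    SatisfiesStrongConvexity (halfspaceConst / 4) relu D := by
  intro u v
  have h1 := hc.integral_relu_sq_ge h u v
  have h2 := hc.integral_relu_sq_ge h v u
  rw [← h.inner_chow] at h1 h2
  rw [← neg_sub u v, inner_neg_right, norm_neg] at h2
  rw [inner_sub_left]
  linarith

theorem surrogateLoss_relu_eq (h : IsIsotropic D.fst)
    (hy : Integrable (fun p => p.2 • p.1) D) (w : EuclideanSpace ℝ (Fin d)) :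
    surrogateLoss relu D w
      = ∫ x, relu ⟪w, x⟫ ^ 2 / 2 ∂D.fst - ⟪w, ∫ p, p.2 • p.1 ∂D⟫ := by
  have hi := (h.memLp_relu_inner w).integrable_sq.div_const 2
  have hfst : ∫ x, relu ⟪w, x⟫ ^ 2 / 2 ∂D.fst = ∫ p, relu ⟪w, p.1⟫ ^ 2 / 2 ∂D :=
    integral_map measurable_fst.aemeasurable hi.aestronglyMeasurable
  have hi' : Integrable (fun p : EuclideanSpace ℝ (Fin d) × ℝ => relu ⟪w, p.1⟫ ^ 2 / 2) D :=
    hi.comp_measurable measurable_fst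
  rw [hfst, ← integral_inner hy, ← integral_sub hi' (hy.const_inner w), surrogateLoss]
  simp only [integral_relu_sub, real_inner_smul_right]

theorem strongConvexOn_surrogateLoss_relu [IsProbabilityMeasure D]
    (h : IsIsotropic D.fst) (hc : IsLogConcave D.fst)
    (hy : Integrable (fun p => p.2 • p.1) D) :
    StrongConvexOn univ (halfspaceConst / 4) (surrogateLoss relu D) := by
  refine ⟨convex_univ, fun u _ v _ a b ha hb hab => ?_⟩
  simp only [surrogateLoss_relu_eq h hy, smul_eq_mul]
  -- Both Bregman bounds are based at z. Weighted by a and b, their linear terms cancel and the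
  -- quadratic ones add up through ab² + ba² = ab.
  set z := a • u + b • v with hz
  have h1 := hc.integral_relu_sq_ge h u z
  have h2 := hc.integral_relu_sq_ge h v z
  rw [← h.inner_chow] at h1 h2
  have hbe : b = 1 - a := by linarith
  have e1 : u - z = b • (u - v) := by rw [hz, hbe]; module
  have e2 : v - z = -(a • (u - v)) := by rw [hz, hbe]; module
  rw [e1, norm_smul, Real.norm_of_nonneg hb, real_inner_smul_right] at h1
  rw [e2, norm_neg, norm_smul, Real.norm_of_nonneg ha, inner_neg_right,
    real_inner_smul_right] at h2
  have h3 := mul_le_mul_of_nonneg_left h1 ha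
  have h4 := mul_le_mul_of_nonneg_left h2 hb
  rw [hz, inner_add_left, real_inner_smul_left, real_inner_smul_left, ← hz]
  rw [hbe] at h3 h4 ⊢
  linarith

end

end

theorem lemma5p2 :
    ∃ m : ℝ, 0 < m ∧
      ∀ (d : ℕ) (D : Measure (EuclideanSpace ℝ (Fin d) × ℝ)) [IsProbabilityMeasure D],
        IsIsotropic D.fst → IsLogConcave D.fst →
          SatisfiesStrongConvexity m relu D ∧
          (Integrable (fun p => p.2 • p.1) D →
            StrongConvexOn Set.univ m (surrogateLoss relu D)) :=
  ⟨halfspaceConst / 4, div_pos halfspaceConst_pos four_pos, fun _ _ _ h hc =>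
    ⟨satisfiesStrongConvexity_relu h hc, strongConvexOn_surrogateLoss_relu h hc⟩⟩
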